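/- **Corollary 3.18.** There exist a profinite group $X$ and a continuous action of the discrete group $\mathbb{Z}$ on $X$ by group automorphisms such that the topological semidirect product $G = X \rtimes \mathbb{Z}$ (with the product topology) is a locally compact Polish non-archimedean topological group, and the $G$-space $G_c$ is not Rosenthal representable. Here a topological group is *non-archimedean* if its open subgroups form a base of neighbourhoods of the identity; $G_c$ denotes the space $G$ with the conjugation action $(g,x) \mapsto gxg^{-1}$ of $G$. For a real Banach space $V$, let $\mathrm{Iso}_l(V)$ be the group of surjective linear isometries of $V$ with the strong operator topology; it acts on the dual $V^*$ by $(Tu)(v) = u(T^{-1}v)$. A $G$-space $Y$ is *Rosenthal representable* if there are a real Banach space $V$ that contains no isomorphic copy of $\ell_1$ (a Rosenthal space), a continuous homomorphism $h\colon G \to \mathrm{Iso}_l(V)$, and a norm-bounded map $\alpha\colon Y \to V^*$ that is a topological embedding for the weak-star topology of $V^*$ and satisfies $\alpha(gy) = h(g)\alpha(y)$ for all $g \in G$, $y \in Y$. -/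

import Mathlib

open Topology

universe u v w

/-- The group `Iso_l(V)` of (surjective) linear isometries of a real normed space `V` carries the
strong operator topology, i.e. the topology of pointwise convergence on `V`. -/
instance LinearIsometryEquiv.strongOperatorTopology (V : Type u) [NormedAddCommGroup V]
    [NormedSpace ℝ V] : TopologicalSpace (V ≃ₗᵢ[ℝ] V) :=
  TopologicalSpace.induced (fun T : V ≃ₗᵢ[ℝ] V => (fun x => T x : V → V)) inferInstance

/-- The canonical dual action of `Iso_l(V)` on `V*`: `(T u)(x) = u (T⁻¹ x)`. -/
noncomputable def dualAction {V : Type u} [NormedAddCommGroup V] [NormedSpace ℝ V]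
    (T : V ≃ₗᵢ[ℝ] V) (f : WeakDual ℝ V) : WeakDual ℝ V :=
  StrongDual.toWeakDual
    ((WeakDual.toStrongDual f).comp ((T⁻¹ : V ≃ₗᵢ[ℝ] V).toContinuousLinearEquiv : V →L[ℝ] V))

theorem dualAction_apply {V : Type u} [NormedAddCommGroup V] [NormedSpace ℝ V]
    (T : V ≃ₗᵢ[ℝ] V) (f : WeakDual ℝ V) (x : V) : dualAction T f x = f (T⁻¹ x) := rfl

/-- A representation of the `G`-space `X` on the Banach space `V`: a continuous homomorphism
`h : G → Iso_l(V)` together with a weak-star continuous, norm bounded, `G`-equivariant map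
`α : X → V*`. -/
structure BanachRepresentation (G : Type v) [Group G] [TopologicalSpace G]
    (X : Type w) [TopologicalSpace X] [MulAction G X]
    (V : Type u) [NormedAddCommGroup V] [NormedSpace ℝ V] where
  /-- the homomorphism into the group of linear isometries -/
  h : G →* (V ≃ₗᵢ[ℝ] V)
  continuous_h : Continuous h
  /-- the map into the dual, which carries the weak-star topology -/
  α : X → WeakDual ℝ V
  continuous_α : Continuous α
  bounded_α : ∃ C : ℝ, ∀ x : X, ‖WeakDual.toStrongDual (α x)‖ ≤ C
  equivariant : ∀ (g : G) (x : X), α (g • x) = dualAction (h g) (α x)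

/-- A representation is proper if `α` is a topological embedding into `V*` with its weak-star
topology. -/
def BanachRepresentation.IsProper {G : Type v} [Group G] [TopologicalSpace G]
    {X : Type w} [TopologicalSpace X] [MulAction G X]
    {V : Type u} [NormedAddCommGroup V] [NormedSpace ℝ V]
    (ρ : BanachRepresentation G X V) : Prop :=
  IsEmbedding ρ.α

/-- A Rosenthal space: a normed space (used for Banach spaces only) no linear subspace of which is
isomorphic, as a topological vector space, to `ℓ₁`. -/
def IsRosenthalSpace (V : Type u) [NormedAddCommGroup V] [NormedSpace ℝ V] : Prop :=
  ¬ ∃ W : Submodule ℝ V, Nonempty (lp (fun _ : ℕ => ℝ) 1 ≃L[ℝ] W)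

/-- The `G`-space `X` is Rosenthal representable if it has a proper representation on some
Rosenthal Banach space. -/
def RosenthalRepresentable (G : Type v) [Group G] [TopologicalSpace G]
    (X : Type w) [TopologicalSpace X] [MulAction G X] : Prop :=
  ∃ (V : Type u) (_ : NormedAddCommGroup V) (_ : NormedSpace ℝ V),
    CompleteSpace V ∧ IsRosenthalSpace V ∧ ∃ ρ : BanachRepresentation G X V, ρ.IsProper

/-- The `G`-space `G_c`: the space `G` with the conjugation action `g • x = g x g⁻¹`. -/
def ConjSpace (G : Type v) : Type v := G

/-- `G_c` has the topology of `G`. -/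
instance (G : Type v) [t : TopologicalSpace G] : TopologicalSpace (ConjSpace G) := t

/-- The conjugation action of `G` on `G_c`. -/
instance (G : Type v) [Group G] : MulAction G (ConjSpace G) where
  smul g x := MulAut.conj g (show G from x)
  one_smul x := show MulAut.conj (1 : G) (show G from x) = x by rw [map_one]; rfl
  mul_smul g k x := show MulAut.conj (g * k) (show G from x) =
    MulAut.conj g (MulAut.conj k (show G from x)) by rw [map_mul]; rfl

theorem ConjSpace.smul_def {G : Type v} [Group G] (g x : G) :
    g • (show ConjSpace G from x) = (show ConjSpace G from (g * x * g⁻¹ : G)) := rfl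

/-- `G_c` is a `G`-space: the conjugation action is continuous. -/
instance (G : Type v) [Group G] [TopologicalSpace G] [IsTopologicalGroup G] :
    ContinuousSMul G (ConjSpace G) where
  continuous_smul := show Continuous fun p : G × G => p.1 * p.2 * p.1⁻¹ by fun_prop

/-- The topology of a semidirect product `N ⋊[φ] H` is the product topology of `N × H`. -/
instance SemidirectProduct.productTopology {N : Type v} {H : Type w} [Group N] [Group H]
    [TopologicalSpace N] [TopologicalSpace H] (φ : H →* MulAut N) :
    TopologicalSpace (N ⋊[φ] H) :=
  TopologicalSpace.induced (fun g : N ⋊[φ] H => (g.left, g.right)) inferInstance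

/-! Take the full shift `X = {±1}^ℤ`. Inside `G_c`, conjugation by `n : ℤ` shifts `X`, so a
representation on `V` restricts to a bounded weak-star continuous `β` on `X` with `β z (h(n)⁻¹ v) =
β (n·z) v`. Let `v` separate two points `x`, `y`. By continuity `z ↦ β z v` is nearly constant on
points agreeing with `x`, or with `y`, on a finite window. Placing copies of `x` and `y` at will on
disjoint translates of that window makes the vectors `h(n)⁻¹ v`, for `n` a multiple of the window
length, an independent sequence, and such a sequence spans `ℓ₁`. -/

/-- A bounded sequence in a Banach space on which bounded functionals realise all sign patterns
with a uniform gap spans an isomorphic copy of `ℓ₁`. -/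
theorem not_isRosenthalSpace_of_independent {V : Type u} [NormedAddCommGroup V] [NormedSpace ℝ V]
    [CompleteSpace V] (v : ℕ → V) (M C δ : ℝ) (hδ : 0 < δ) (hv : ∀ k, ‖v k‖ ≤ M)
    (hind : ∀ s : Set ℕ, ∃ u : StrongDual ℝ V, ‖u‖ ≤ C ∧ (∀ k ∈ s, δ ≤ u (v k)) ∧
      ∀ k ∉ s, u (v k) ≤ -δ) : ¬ IsRosenthalSpace V := by
  have hnorm (c : lp (fun _ : ℕ => ℝ) 1) : HasSum (fun k => |c k|) ‖c‖ := by
    simpa using lp.hasSum_norm (p := 1) (by norm_num) c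
  have hle (c : lp (fun _ : ℕ => ℝ) 1) (k : ℕ) : ‖c k • v k‖ ≤ |c k| * M := by
    rw [norm_smul, Real.norm_eq_abs]
    exact mul_le_mul_of_nonneg_left (hv k) (abs_nonneg _)
  have hsum (c : lp (fun _ : ℕ => ℝ) 1) : Summable fun k => c k • v k :=
    Summable.of_norm_bounded ((hnorm c).summable.mul_right M) (hle c)
  let T₀ : lp (fun _ : ℕ => ℝ) 1 →ₗ[ℝ] V :=
    { toFun := fun c => ∑' k, c k • v k
      map_add' := fun c d => by
        rw [← (hsum c).tsum_add (hsum d)]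
        simp only [lp.coeFn_add, Pi.add_apply, add_smul]
      map_smul' := fun a c => by
        rw [RingHom.id_apply, ← (hsum c).tsum_const_smul a]
        simp only [lp.coeFn_smul, Pi.smul_apply, smul_assoc] }
  let T : lp (fun _ : ℕ => ℝ) 1 →L[ℝ] V := T₀.mkContinuous M fun c => by
    rw [mul_comm]
    exact tsum_of_norm_bounded ((hnorm c).mul_right M) (hle c)
  have hlower (c : lp (fun _ : ℕ => ℝ) 1) : δ * ‖c‖ ≤ C * ‖T c‖ := by
    -- Matching the sign pattern of `c` makes each term `c k * u (v k)` at least `δ * |c k|`.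
    obtain ⟨u, hu, hpos, hneg⟩ := hind {k | 0 ≤ c k}
    have hTu : HasSum (fun k => c k * u (v k)) (u (T c)) := by
      have h := (hsum c).hasSum.mapL u
      simp only [map_smul, smul_eq_mul] at h
      exact h
    calc δ * ‖c‖ ≤ u (T c) := by
          refine hasSum_le (fun k => ?_) ((hnorm c).mul_left δ) hTu
          by_cases hk : 0 ≤ c k
          · rw [abs_of_nonneg hk]
            nlinarith [hpos k hk]
          · rw [abs_of_neg (not_le.1 hk)]
            nlinarith [hneg k hk]
      _ ≤ ‖u (T c)‖ := le_abs_self _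
      _ ≤ C * ‖T c‖ := u.le_of_opNorm_le hu _
  have hC : 0 < C := by
    obtain ⟨u, hu, hpos, -⟩ := hind Set.univ
    have hu0 : u ≠ 0 := fun h => by
      have := hpos 0 trivial
      rw [h, zero_apply] at this
      exact absurd this (not_le.2 hδ)
    exact (norm_pos_iff.2 hu0).trans_le hu
  have hanti : AntilipschitzWith (C / δ).toNNReal T := by
    refine AddMonoidHomClass.antilipschitz_of_bound T fun c => ?_
    rw [Real.coe_toNNReal _ (by positivity), div_mul_eq_mul_div, le_div_iff₀ hδ, mul_comm]
    exact hlower c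
  have hinj := hanti.injective
  have hclosed := hanti.isClosed_range T.uniformContinuous
  exact fun hR => hR ⟨_, ⟨T.equivRange hinj hclosed⟩⟩

/-- The action of `ℤ` on the full shift `ℤ → F` by translation of coordinates. -/
def shiftHom (F : Type v) [Group F] : Multiplicative ℤ →* MulAut (ℤ → F) where
  toFun n :=
    { toFun := fun x i => x (i + n.toAdd)
      invFun := fun x i => x (i - n.toAdd)
      left_inv := fun x => by ext i; simp
      right_inv := fun x => by ext i; simp
      map_mul' := fun _ _ => rfl }
  map_one' := by ext x i; simp
  map_mul' m n := by ext x i; simp [add_assoc]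

theorem shiftHom_apply {F : Type v} [Group F] (n : Multiplicative ℤ) (x : ℤ → F) (i : ℤ) :
    shiftHom F n x i = x (i + n.toAdd) := rfl

theorem continuous_shiftHom (F : Type v) [Group F] [TopologicalSpace F] :
    Continuous fun p : Multiplicative ℤ × (ℤ → F) => shiftHom F p.1 p.2 := by
  rw [continuous_prod_of_discrete_left]
  exact fun n => continuous_pi fun i => continuous_apply (i + n.toAdd)

/-- A continuous function on a full shift depends, up to `ε` at a given point, only on finitely
many coordinates. -/
theorem exists_window {F : Type v} [TopologicalSpace F] [DiscreteTopology F]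
    {f : (ℤ → F) → ℝ} (hf : Continuous f) (x : ℤ → F) {ε : ℝ} (hε : 0 < ε) :
    ∃ N : ℕ, ∀ z : ℤ → F, (∀ r : ℤ, |r| ≤ N → z r = x r) → |f z - f x| < ε := by
  have hopen : IsOpen {z | |f z - f x| < ε} :=
    isOpen_lt (by fun_prop) continuous_const
  obtain ⟨I, u, hu, hsub⟩ := isOpen_pi_iff.1 hopen x (by simpa using hε)
  refine ⟨I.sup Int.natAbs, fun z hz => hsub fun i hi => ?_⟩
  rw [hz i]
  · exact (hu i hi).2
  · have : i.natAbs ≤ I.sup Int.natAbs := Finset.le_sup (f := Int.natAbs) hi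
    rw [Int.abs_eq_natAbs]
    exact_mod_cast this

/-- Points of a full shift can be prescribed independently on disjoint translates of a window. -/
theorem exists_shift_eq {F : Type v} [Group F] (N : ℕ) (p : ℕ → ℤ → F) :
    ∃ z : ℤ → F, ∀ (k : ℕ) (r : ℤ), |r| ≤ N →
      shiftHom F (Multiplicative.ofAdd ((k : ℤ) * (2 * N + 1))) z r = p k r := by
  -- Block `k` is centred at `k * (2N + 1)` with radius `N`, hence the offset `N` before dividing.
  -- Blocks of negative index get an irrelevant value from `toNat`.
  refine ⟨fun i => p ((i + N) / (2 * N + 1)).toNat (i - (i + N) / (2 * N + 1) * (2 * N + 1)),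
    fun k r hr => ?_⟩
  rw [abs_le] at hr
  have hk : (r + (k : ℤ) * (2 * N + 1) + N) / (2 * N + 1) = k := by
    rw [add_right_comm, Int.add_mul_ediv_right _ _ (by omega),
      Int.ediv_eq_zero_of_lt (by omega) (by omega), zero_add]
  rw [shiftHom_apply, toAdd_ofAdd]
  simp only [hk, Int.toNat_natCast, add_sub_cancel_right]

namespace SemidirectProduct

variable {N : Type v} {H : Type w} [Group N] [Group H] [TopologicalSpace N] [TopologicalSpace H]
  (φ : H →* MulAut N)

/-- A topological semidirect product is homeomorphic to the product of its factors. -/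
def homeomorphProd : N ⋊[φ] H ≃ₜ N × H :=
  equivProd.toHomeomorphOfIsInducing ⟨rfl⟩

theorem continuous_left : Continuous fun g : N ⋊[φ] H => g.left :=
  continuous_fst.comp (homeomorphProd φ).continuous

theorem continuous_right : Continuous fun g : N ⋊[φ] H => g.right :=
  continuous_snd.comp (homeomorphProd φ).continuous

theorem isTopologicalGroup [IsTopologicalGroup N] [IsTopologicalGroup H]
    (hφ : Continuous fun p : H × N => φ p.1 p.2) : IsTopologicalGroup (N ⋊[φ] H) where
  continuous_mul := by
    refine (homeomorphProd φ).isInducing.continuous_iff.2 (Continuous.prodMk ?_ ?_)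
    · exact ((continuous_left φ).comp continuous_fst).mul (hφ.comp
        (((continuous_right φ).comp continuous_fst).prodMk
          ((continuous_left φ).comp continuous_snd)))
    · exact ((continuous_right φ).comp continuous_fst).mul
        ((continuous_right φ).comp continuous_snd)
  continuous_inv := by
    refine (homeomorphProd φ).isInducing.continuous_iff.2 (Continuous.prodMk ?_ ?_)
    · exact hφ.comp ((continuous_right φ).inv.prodMk (continuous_left φ).inv)
    · exact (continuous_right φ).inv

theorem continuous_inl : Continuous (inl : N →* N ⋊[φ] H) :=
  (homeomorphProd φ).isInducing.continuous_iff.2 (continuous_id.prodMk continuous_const)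

/-- Discreteness of `H` makes the slice over `1` open, so small open subgroups of `N` remain open in
the product. -/
theorem isOpenEmbedding_inl [DiscreteTopology H] :
    IsOpenEmbedding (inl : N →* N ⋊[φ] H) := by
  have h : IsOpenEmbedding fun n : N => (n, (1 : H)) :=
    .of_continuous_injective_isOpenMap (continuous_id.prodMk continuous_const)
      (fun a b hab => congrArg Prod.fst hab) fun U hU => by
        have : (fun n : N => (n, (1 : H))) '' U = U ×ˢ {1} := by
          ext ⟨a, b⟩
          simp [eq_comm]
        rw [this]
        exact hU.prod (isOpen_discrete _)
  exact (homeomorphProd φ).symm.isOpenEmbedding.comp h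

end SemidirectProduct

/-- A Banach space that carries a representation of the conjugation action of
`(ℤ → F) ⋊ ℤ` separating two points of the full shift contains `ℓ₁`. -/
theorem not_isRosenthalSpace_of_conj_shift {F : Type v} [Group F] [TopologicalSpace F]
    [DiscreteTopology F] {V : Type u} [NormedAddCommGroup V] [NormedSpace ℝ V] [CompleteSpace V]
    (ρ : BanachRepresentation ((ℤ → F) ⋊[shiftHom F] Multiplicative ℤ)
      (ConjSpace ((ℤ → F) ⋊[shiftHom F] Multiplicative ℤ)) V)
    {x y : ℤ → F}
    (hxy : ρ.α (SemidirectProduct.inl x : (ℤ → F) ⋊[shiftHom F] Multiplicative ℤ) ≠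
      ρ.α (SemidirectProduct.inl y : (ℤ → F) ⋊[shiftHom F] Multiplicative ℤ)) :
    ¬ IsRosenthalSpace V := by
  let β : (ℤ → F) → WeakDual ℝ V := fun z =>
    ρ.α (SemidirectProduct.inl z : (ℤ → F) ⋊[shiftHom F] Multiplicative ℤ)
  obtain ⟨C, hC⟩ := ρ.bounded_α
  have hβ : Continuous β := ρ.continuous_α.comp (SemidirectProduct.continuous_inl _)
  obtain ⟨v, hv⟩ : ∃ v, β x v < β y v := by
    obtain ⟨v, hv⟩ := DFunLike.ne_iff.1 hxy
    rcases lt_or_gt_of_ne hv with h | h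
    · exact ⟨v, h⟩
    · exact ⟨-v, by simpa [β] using h⟩
  let g : Multiplicative ℤ → V := fun n => (ρ.h (SemidirectProduct.inr n))⁻¹ v
  have hg (n : Multiplicative ℤ) (z : ℤ → F) : β z (g n) = β (shiftHom F n z) v := by
    have h := ρ.equivariant (SemidirectProduct.inr n)
      (SemidirectProduct.inl z : (ℤ → F) ⋊[shiftHom F] Multiplicative ℤ)
    have h' : β (shiftHom F n z) = dualAction (ρ.h (SemidirectProduct.inr n)) (β z) := by
      rw [← h]
      refine congrArg ρ.α (?_ : SemidirectProduct.inl (shiftHom F n z) =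
        SemidirectProduct.inr n * SemidirectProduct.inl z * (SemidirectProduct.inr n)⁻¹)
      rw [SemidirectProduct.inl_aut, map_inv]
    rw [h', dualAction_apply]
  have hf : Continuous fun z => β z v := (WeakDual.eval_continuous v).comp hβ
  -- An error of one third of the gap at each end leaves one third as the separation `δ`.
  have hε : 0 < (β y v - β x v) / 3 := by linarith
  obtain ⟨N₁, h₁⟩ := exists_window hf x hε
  obtain ⟨N₂, h₂⟩ := exists_window hf y hε
  let N := max N₁ N₂
  refine not_isRosenthalSpace_of_independent
    (fun k : ℕ => g (Multiplicative.ofAdd ((k : ℤ) * (2 * N + 1)))) ‖v‖ (C + C) _ hε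
    (fun k => ((ρ.h _)⁻¹.norm_map v).le) fun s => ?_
  classical
  obtain ⟨z, hz⟩ := exists_shift_eq N fun k => if k ∈ s then y else x
  -- Subtracting the swapped pattern centres the two levels at zero, at the cost of doubling the
  -- norm bound.
  obtain ⟨z', hz'⟩ := exists_shift_eq N fun k => if k ∈ s then x else y
  have hx (t : ℤ → F) (ht : ∀ r : ℤ, |r| ≤ N → t r = x r) :=
    abs_lt.1 (h₁ t fun r hr => ht r (hr.trans (by simp [N])))
  have hy (t : ℤ → F) (ht : ∀ r : ℤ, |r| ≤ N → t r = y r) :=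
    abs_lt.1 (h₂ t fun r hr => ht r (hr.trans (by simp [N])))
  refine ⟨WeakDual.toStrongDual (β z) - WeakDual.toStrongDual (β z'),
    (norm_sub_le _ _).trans (add_le_add (hC _) (hC _)), fun k hk => ?_, fun k hk => ?_⟩
  · have hzk := hy _ fun r hr => (hz k r hr).trans (by rw [if_pos hk])
    have hzk' := hx _ fun r hr => (hz' k r hr).trans (by rw [if_pos hk])
    rw [← hg] at hzk hzk'
    change _ ≤ β z _ - β z' _
    linarith [hzk.1, hzk'.2]
  · have hzk := hx _ fun r hr => (hz k r hr).trans (by rw [if_neg hk])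
    have hzk' := hy _ fun r hr => (hz' k r hr).trans (by rw [if_neg hk])
    rw [← hg] at hzk hzk'
    change β z _ - β z' _ ≤ _
    linarith [hzk.2, hzk'.1]

theorem nonarchimedeanGroup_of_profinite (X : Type v) [Group X] [TopologicalSpace X]
    [IsTopologicalGroup X] [CompactSpace X] [T2Space X] [TotallyDisconnectedSpace X] :
    NonarchimedeanGroup X where
  is_nonarchimedean U hU := by
    obtain ⟨W, hWU, hW, h1⟩ := mem_nhds_iff.1 hU
    obtain ⟨H, hH⟩ := ProfiniteGrp.exist_openNormalSubgroup_sub_open_nhds_of_one hW h1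
    exact ⟨H.toOpenSubgroup, hH.trans hWU⟩

theorem corollary3p18 :
    ∃ (X : Type) (_ : Group X) (_ : TopologicalSpace X) (φ : Multiplicative ℤ →* MulAut X),
      -- `X` is a profinite group
      (IsTopologicalGroup X ∧ CompactSpace X ∧ T2Space X ∧ TotallyDisconnectedSpace X) ∧
      -- the discrete group `ℤ` acts continuously on `X` by automorphisms
      (Continuous fun p : Multiplicative ℤ × X => φ p.1 p.2) ∧
      -- `G = X ⋊ ℤ` is a locally compact Polish non-archimedean topological group
      LocallyCompactSpace (X ⋊[φ] Multiplicative ℤ) ∧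
      PolishSpace (X ⋊[φ] Multiplicative ℤ) ∧
      NonarchimedeanGroup (X ⋊[φ] Multiplicative ℤ) ∧
      -- and `G_c` has no proper representation on a Rosenthal Banach space
      ¬ RosenthalRepresentable.{u} (X ⋊[φ] Multiplicative ℤ)
          (ConjSpace (X ⋊[φ] Multiplicative ℤ)) := by
  have hc := continuous_shiftHom ℤˣ
  have hG := SemidirectProduct.isTopologicalGroup (shiftHom ℤˣ) hc
  let e := SemidirectProduct.homeomorphProd (shiftHom ℤˣ)
  have hX := nonarchimedeanGroup_of_profinite (ℤ → ℤˣ)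
  have : PolishSpace ℤˣ := inferInstance
  refine ⟨ℤ → ℤˣ, inferInstance, inferInstance, shiftHom ℤˣ,
    ⟨inferInstance, inferInstance, inferInstance, inferInstance⟩, hc,
    e.isClosedEmbedding.locallyCompactSpace, e.isClosedEmbedding.polishSpace,
    NonarchimedeanGroup.nonarchimedean_of_emb _
      (SemidirectProduct.isOpenEmbedding_inl (shiftHom ℤˣ)), ?_⟩
  rintro ⟨V, _, _, _, hV, ρ, hρ⟩
  refine not_isRosenthalSpace_of_conj_shift (x := 1) (y := -1) ρ (fun h => ?_) hV
  have h1 := SemidirectProduct.inl_injective (hρ.injective h)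
  exact absurd (congrFun h1 0) (by decide)
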